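/- Let $k\ge 1$ and let $\Lambda_1,\dots,\Lambda_k$ be real Hilbert spaces (not necessarily separable), with the metrics $d_{\Lambda_i}$ given by their norms. A labelled $k$-partitioned measure network is a tuple $L=((X_i,\mu_i)_{i=1}^k,\omega,(\iota_i)_{i=1}^k)$, where each $X_i$ is a Polish space with a Borel probability measure $\mu_i$, and, with $X=\bigsqcup_i X_i$ and $\mu=\sum_i\mu_i$, $\omega:X\times X\to[0,\infty)$ belongs to $L^2(\mu\otimes\mu)$; each $\iota_i:X_i\to\Lambda_i$ is Borel measurable, and $(x,y)\mapsto d_{\Lambda_i}(\iota_i(x),\iota_i(y))$ belongs to $L^2(\mu_i\otimes\mu_i)$. Let $\mathcal{LP}_k$ be the collection of all such networks. For $L,L'\in\mathcal{LP}_k$ set \[ d_{\mathcal{LP}_k}(L,L')=\inf_{(\pi_i)}\ \frac12\left(\sum_{i,j=1}^k\|\omega-\omega'\|_{L^2(\pi_i\otimes\pi_j)}^2+\sum_{i=1}^k\|d_{\Lambda_i}\circ(\iota_i,\iota_i')\|_{L^2(\pi_i)}^2\right)^{1/2}, \] where the infimum is over all families $(\pi_i)_{i=1}^k$ in which $\pi_i$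 is a coupling of $\mu_i$ and $\mu_i'$, and $(\omega-\omega')((x,x'),(y,y'))=\omega(x,y)-\omega'(x',y')$. Call $L$ and $L'$ weakly isomorphic if there are $\overline L=((\overline X_i,\overline\mu_i),\overline\omega,(\overline\iota_i))\in\mathcal{LP}_k$ and measurable maps $\phi_i:\overline X_i\to X_i$, $\phi_i':\overline X_i\to X_i'$ with $(\phi_i)_\#\overline\mu_i=\mu_i$, $(\phi'_i)_\#\overline\mu_i=\mu'_i$ such that, for all $i,j$, $\overline\omega(x,y)=\omega(\phi_i(x),\phi_j(y))=\omega'(\phi'_i(x),\phi'_j(y))$ for $\overline\mu_i\otimes\overline\mu_j$-almost every $(x,y)$ and $\overline\iota_i(x)=\iota_i(\phi_i(x))=\iota_i'(\phi_i'(x))$ for $\overline\mu_i$-almost every $x$. Let $[\mathcal{LP}_k]$ be the set of weak isomorphism classes. Then $d_{\mathcal{LP}_k}$ induces a well-defined metric on $[\mathcal{LP}_k]$, and the metric space $([\mathcal{LP}_k],d_{\mathcal{LP}_k})$ is complete. -/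

import Mathlib

open MeasureTheory
open scoped ENNReal

universe u v

/-- A `k`-partitioned measure `2`-network: Polish probability spaces `(X i, μ i)`, `i : Fin k`,
whose disjoint union is modelled by the sigma type `Σ i, X i` and carries the measure `∑ i, μ i`
(each `μ i` pushed forward along the inclusion), together with a nonnegative square integrable
kernel `ω` on the square of the disjoint union. -/
structure PartitionedNetwork (k : ℕ) where
  /-- the classes of nodes -/
  X : Fin k → Type u
  [top : ∀ i, TopologicalSpace (X i)]
  [polish : ∀ i, PolishSpace (X i)]
  [meas : ∀ i, MeasurableSpace (X i)]
  [borel : ∀ i, BorelSpace (X i)]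
  /-- the node measures -/
  μ : ∀ i, Measure (X i)
  [prob : ∀ i, IsProbabilityMeasure (μ i)]
  /-- the network kernel -/
  ω : (Σ i, X i) → (Σ i, X i) → ℝ
  ω_nonneg : ∀ x y, 0 ≤ ω x y
  ω_memLp : MemLp (fun z : (Σ i, X i) × (Σ i, X i) => ω z.1 z.2) 2
    ((∑ i, (μ i).map (fun x => (⟨i, x⟩ : Σ i, X i))).prod
      (∑ i, (μ i).map (fun x => (⟨i, x⟩ : Σ i, X i))))

attribute [instance] PartitionedNetwork.top PartitionedNetwork.polish PartitionedNetwork.meas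
  PartitionedNetwork.borel PartitionedNetwork.prob

/-- A labelled `k`-partitioned measure `2`-network with labels in the metric spaces `Λ i`. -/
structure LabelledNetwork (k : ℕ) (Λ : Fin k → Type v) [∀ i, MetricSpace (Λ i)]
    [∀ i, MeasurableSpace (Λ i)] [∀ i, BorelSpace (Λ i)] extends PartitionedNetwork.{u} k where
  /-- the labelling functions -/
  ι : ∀ i, X i → Λ i
  ι_measurable : ∀ i, Measurable (ι i)
  ι_memLp : ∀ i, MemLp (fun z : X i × X i => dist (ι i z.1) (ι i z.2)) 2 ((μ i).prod (μ i))

/-- `(φ i)` is a weak isomorphism from the partitioned network `P` to `P'`. -/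
structure PartitionedNetwork.IsWeakIsomorphism {k : ℕ} (P P' : PartitionedNetwork.{u} k)
    (φ : ∀ i, P.X i → P'.X i) : Prop where
  measurePreserving : ∀ i, MeasurePreserving (φ i) (P.μ i) (P'.μ i)
  kernel_eq : ∀ i j, ∀ᵐ z ∂((P.μ i).prod (P.μ j)),
    P.ω ⟨i, z.1⟩ ⟨j, z.2⟩ = P'.ω ⟨i, φ i z.1⟩ ⟨j, φ j z.2⟩

/-- The set of couplings of two measures. -/
def couplings {A B : Type u} [MeasurableSpace A] [MeasurableSpace B]
    (μ : Measure A) (ν : Measure B) : Set (Measure (A × B)) :=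
  {π | π.map Prod.fst = μ ∧ π.map Prod.snd = ν}

/-- The set of `k`-partitioned couplings of two partitioned networks. -/
def PartitionedNetwork.partitionedCouplings {k : ℕ} (P P' : PartitionedNetwork.{u} k) :
    Set (∀ i, Measure (P.X i × P'.X i)) :=
  {π | ∀ i, π i ∈ couplings (P.μ i) (P'.μ i)}

namespace LabelledNetwork

variable {k : ℕ} {Λ : Fin k → Type v} [∀ i, MetricSpace (Λ i)]
  [∀ i, MeasurableSpace (Λ i)] [∀ i, BorelSpace (Λ i)]

/-- Weak isomorphism of labelled partitioned networks: both are the image of a third labelled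
network under weak isomorphisms that are compatible with the labels almost everywhere. -/
def WeaklyIsomorphic (L L' : LabelledNetwork.{u, v} k Λ) : Prop :=
  ∃ (M : LabelledNetwork.{u, v} k Λ) (φ : ∀ i, M.X i → L.X i) (φ' : ∀ i, M.X i → L'.X i),
    M.toPartitionedNetwork.IsWeakIsomorphism L.toPartitionedNetwork φ ∧
    M.toPartitionedNetwork.IsWeakIsomorphism L'.toPartitionedNetwork φ' ∧
    ∀ i, ∀ᵐ x ∂(M.μ i), M.ι i x = L.ι i (φ i x) ∧ M.ι i x = L'.ι i (φ' i x)

/-- The objective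
`(1/2) (∑ i j, ‖ω - ω'‖² + ∑ i, ‖d ∘ (ι i, ι' i)‖²)^(1/2)` of a family `π`, where the norms are
those of `L²(π i ⊗ π j)` and of `L²(π i)`. -/
noncomputable def cost (L L' : LabelledNetwork.{u, v} k Λ)
    (π : ∀ i, Measure (L.X i × L'.X i)) : ℝ≥0∞ :=
  (1 / 2) *
    ((∑ i, ∑ j,
        eLpNorm (fun z : (L.X i × L'.X i) × (L.X j × L'.X j) =>
          L.ω ⟨i, z.1.1⟩ ⟨j, z.2.1⟩ - L'.ω ⟨i, z.1.2⟩ ⟨j, z.2.2⟩) 2 ((π i).prod (π j)) ^ 2) +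
      ∑ i, eLpNorm (fun z : L.X i × L'.X i => dist (L.ι i z.1) (L'.ι i z.2)) 2 (π i) ^ 2)
    ^ (1 / 2 : ℝ)

/-- The labelled `k`-partitioned network distance, with values in `[0, ∞]`. -/
noncomputable def networkDist (L L' : LabelledNetwork.{u, v} k Λ) : ℝ≥0∞ :=
  ⨅ π ∈ L.toPartitionedNetwork.partitionedCouplings L'.toPartitionedNetwork, cost L L' π

end LabelledNetwork

/-- The set of labelled `k`-partitioned networks up to weak isomorphism. -/
def LabelledNetworkClass (k : ℕ) (Λ : Fin k → Type v) [∀ i, MetricSpace (Λ i)]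
    [∀ i, MeasurableSpace (Λ i)] [∀ i, BorelSpace (Λ i)] : Type (max (u + 1) v) :=
  Quot (LabelledNetwork.WeaklyIsomorphic.{u, v} (k := k) (Λ := Λ))

/-- The weak isomorphism class of a labelled network. -/
def LabelledNetwork.toClass {k : ℕ} {Λ : Fin k → Type v} [∀ i, MetricSpace (Λ i)]
    [∀ i, MeasurableSpace (Λ i)] [∀ i, BorelSpace (Λ i)] (L : LabelledNetwork.{u, v} k Λ) :
    LabelledNetworkClass.{u, v} k Λ :=
  Quot.mk _ L

/-! Two networks are compared on common probability spaces. When both node spaces are images of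
spaces `Ω i` under measure-preserving maps, kernels and labels pull back to elements of `L²`, and
half the ℓ² norm of their differences bounds the distance (`networkDist_le`). The triangle
inequality is then Minkowski's inequality on the space supplied by `exists_gluing`.

If the distance is zero, near-optimal couplings accumulate weakly, because couplings form a compact
set (`isCompact_couplings`). The discrepancy vanishes in the limit by approximating kernels and
labels in `L²` by bounded continuous functions: the errors depend only on the fixed marginals
(`eLpNorm_sub_eq_zero_of_tendsto`). The limiting couplings carry the third network that witnesses
weak isomorphism.

For completeness, near-optimal couplings of a sequence with geometrically small gaps are chained
into one Markov law on the product of all node spaces (`exists_measure_pi_of_couplings`). There the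
pulled-back data are Cauchy in `L²`, and their limits define the limit network.

The label spaces may be nonseparable, so Borel labels must first be shown to be strongly measurable;
`isSeparable_range_of_measurable` does this by counting Borel sets. -/

/-! ### Borel maps from Polish spaces have separable range -/

open Set TopologicalSpace Topology Filter Function in
/-- A continuous map on a Polish space with uncountable range is injective on a copy of the
Cantor space. -/
theorem Continuous.exists_nat_bool_injective_comp {X : Type*} {Y : Type*} [TopologicalSpace X]
    [PolishSpace X] [TopologicalSpace Y] [T2Space Y] {h : X → Y} (hc : Continuous h)
    (hr : ¬ (range h).Countable) : ∃ g : (ℕ → Bool) → X, Injective (h ∘ g) := by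
  let _ := upgradeIsCompletelyMetrizable X
  obtain ⟨u, -, upos', hu⟩ := exists_seq_strictAnti_tendsto' (zero_lt_one' ℝ≥0∞)
  have upos := fun n => (upos' n).1
  let P := {U : Set X // IsOpen U ∧ ¬ (h '' U).Countable}
  have split : ∀ (U : P) (ε : ℝ≥0∞), 0 < ε → ∃ U0 U1 : P, closure U0.1 ⊆ U.1 ∧
      closure U1.1 ⊆ U.1 ∧ Metric.ediam U0.1 ≤ ε ∧ Metric.ediam U1.1 ≤ ε ∧
      Disjoint (h '' U0.1) (h '' U1.1) := by
    rintro ⟨U, hU, hUc⟩ ε hε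
    set 𝓑 := countableBasis X
    -- `N` is countable, and every neighbourhood in `U` of a point with value outside `N` has
    -- uncountable image. Two such values can therefore be separated without leaving `P`.
    set N : Set Y := ⋃ V ∈ {V ∈ 𝓑 | (h '' (V ∩ U)).Countable}, h '' (V ∩ U) with hN
    have hNc : N.Countable :=
      ((countable_countableBasis X).mono (sep_subset _ _)).biUnion fun V hV => hV.2
    have key : ∀ x ∈ U, h x ∉ N → ∀ O : Set X, IsOpen O → x ∈ O → ∃ W : P,
        closure W.1 ⊆ U ∧ Metric.ediam W.1 ≤ ε ∧ W.1 ⊆ O := by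
      intro x hx hxN O hO hxO
      obtain ⟨r, hr0, hr⟩ := Metric.nhds_basis_closedEBall.mem_iff.1
        ((hU.inter hO).mem_nhds ⟨hx, hxO⟩)
      obtain ⟨δ, hδ0, hδr, hδε⟩ : ∃ δ : ℝ≥0∞, 0 < δ ∧ δ ≤ r ∧ 2 * δ ≤ ε := by
        refine ⟨min r (ε / 2), lt_min hr0 (ENNReal.half_pos hε.ne'), min_le_left _ _, ?_⟩
        calc 2 * min r (ε / 2) ≤ 2 * (ε / 2) := by gcongr; exact min_le_right _ _
          _ = ε := ENNReal.mul_div_cancel (by simp) (by simp)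
      have hsub : closure (Metric.eball x δ) ⊆ U ∩ O :=
        (closure_minimal Metric.eball_subset_closedEBall Metric.isClosed_closedEBall).trans
          ((Metric.closedEBall_subset_closedEBall hδr).trans hr)
      refine ⟨⟨Metric.eball x δ, Metric.isOpen_eball, fun hcount => hxN ?_⟩,
        hsub.trans inter_subset_left, Metric.ediam_eball_le.trans hδε,
        subset_closure.trans (hsub.trans inter_subset_right)⟩
      obtain ⟨V, hV, hxV, hVs⟩ := (isBasis_countableBasis X).exists_subset_of_mem_open
        (Metric.mem_eball_self hδ0) Metric.isOpen_eball
      exact mem_biUnion (x := V) ⟨hV, hcount.mono (image_mono (inter_subset_left.trans hVs))⟩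
        ⟨x, ⟨hxV, hx⟩, rfl⟩
    have hnt : (h '' U \ N).Nontrivial := by
      by_contra hcon
      rw [Set.not_nontrivial_iff] at hcon
      exact hUc ((hcon.countable.union hNc).mono (by rw [sdiff_union_self]; exact subset_union_left))
    obtain ⟨_, ⟨⟨x, hx, rfl⟩, hxN⟩, _, ⟨⟨y, hy, rfl⟩, hyN⟩, hxy⟩ := hnt
    obtain ⟨O, O', hO, hO', hxO, hyO', hd⟩ := t2_separation hxy
    obtain ⟨W, hW1, hW2, hW3⟩ := key x hx hxN _ (hO.preimage hc) hxO
    obtain ⟨W', hW'1, hW'2, hW'3⟩ := key y hy hyN _ (hO'.preimage hc) hyO'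
    exact ⟨W, W', hW1, hW'1, hW2, hW'2,
      hd.mono (image_subset_iff.2 hW3) (image_subset_iff.2 hW'3)⟩
  choose! C0 C1 hC0 hC1 hd0 hd1 hdisj using split
  -- A binary tree of open sets with uncountable image; siblings have disjoint images. The root has
  -- no diameter bound, so the estimates below start at depth one.
  let D : List Bool → P := fun l => l.rec ⟨univ, isOpen_univ, by rwa [image_univ]⟩
    fun a l ih => bif a then C1 ih (u (l.length + 1)) else C0 ih (u (l.length + 1))
  let A : List Bool → Set X := fun l => (D l).1
  have hanti : CantorScheme.ClosureAntitone A := by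
    intro l a
    cases a
    · exact hC0 _ _ (upos _)
    · exact hC1 _ _ (upos _)
  have hdiam : CantorScheme.VanishingDiam A := by
    intro x
    refine tendsto_of_tendsto_of_tendsto_of_le_of_le' tendsto_const_nhds hu (by simp) ?_
    rw [eventually_atTop]
    refine ⟨1, fun m hm => ?_⟩
    obtain ⟨n, rfl⟩ := Nat.exists_eq_succ_of_ne_zero (Nat.one_le_iff_ne_zero.1 hm)
    rw [PiNat.res_succ]
    cases hx : x n
    · have := hd0 (D (PiNat.res x n)) _ (upos ((PiNat.res x n).length + 1))
      exact this.trans_eq (by rw [PiNat.res_length])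
    · have := hd1 (D (PiNat.res x n)) _ (upos ((PiNat.res x n).length + 1))
      exact this.trans_eq (by rw [PiNat.res_length])
  have hne : ∀ l, (A l).Nonempty := fun l => by
    by_contra hcon
    rw [not_nonempty_iff_eq_empty] at hcon
    exact (D l).2.2 (by change (h '' A l).Countable; simp [hcon])
  have hdom : ∀ x : ℕ → Bool, x ∈ (CantorScheme.inducedMap A).1 := fun x => by
    rw [hanti.map_of_vanishingDiam hdiam hne]
    exact mem_univ _
  refine ⟨fun x => (CantorScheme.inducedMap A).2 ⟨x, hdom x⟩, fun x y hxy => ?_⟩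
  apply PiNat.res_injective
  ext n : 1
  induction n with
  | zero => simp
  | succ n ih =>
    have hx := mem_image_of_mem h (CantorScheme.map_mem (A := A) ⟨x, hdom x⟩ (n + 1))
    have hy := mem_image_of_mem h (CantorScheme.map_mem (A := A) ⟨y, hdom y⟩ (n + 1))
    rw [← show h _ = h _ from hxy] at hy
    simp only [PiNat.res_succ, ← ih] at hx hy ⊢
    congr 1
    have hdis := hdisj (D (PiNat.res x n)) _ (upos ((PiNat.res x n).length + 1))
    cases hxn : x n <;> cases hyn : y n <;> rw [hxn] at hx <;> rw [hyn] at hy <;> try rfl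
    · exact (disjoint_left.1 hdis hx hy).elim
    · exact (disjoint_left.1 hdis hy hx).elim

open Set TopologicalSpace Cardinal Function in
/-- A Borel map from a Polish space to a metric space has separable range. -/
theorem isSeparable_range_of_measurable {X : Type u} {Y : Type v} [TopologicalSpace X]
    [PolishSpace X] [MeasurableSpace X] [BorelSpace X] [MetricSpace Y] [MeasurableSpace Y]
    [BorelSpace Y] {f : X → Y} (hf : Measurable f) : IsSeparable (range f) := by
  by_contra hsep
  obtain ⟨ε, hε, hcov⟩ : ∃ ε : ℝ, 0 < ε ∧ ∀ t : Set Y, t.Countable →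
      ¬ range f ⊆ ⋃ y ∈ t, Metric.closedBall y ε := by
    by_contra! hcon
    obtain ⟨t, -, htc, ht⟩ := EMetric.subset_countable_closure_of_almost_dense_set (range f)
      fun ε hε => by
        obtain ⟨r, hr0, hr⟩ := ENNReal.lt_iff_exists_nnreal_btwn.1 hε
        obtain ⟨t, htc, ht⟩ := hcon r (by simpa using hr0)
        refine ⟨t, htc, ht.trans (iUnion₂_mono fun y _ => ?_)⟩
        rw [← Metric.closedEBall_coe]
        exact Metric.closedEBall_subset_closedEBall hr.le
    exact hsep ⟨t, htc, ht⟩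
  -- By maximality the ε-balls around `f '' T` cover the range, so `T` cannot be countable.
  obtain ⟨T, hT⟩ := zorn_subset {T : Set X | T.Pairwise fun x y => ε < dist (f x) (f y)}
    fun c hc hchain => ⟨⋃₀ c, (pairwise_sUnion hchain.directedOn).2 hc,
      fun s hs => subset_sUnion_of_mem hs⟩
  have hTs : T.Pairwise fun x y => ε < dist (f x) (f y) := hT.1
  have hTc : ¬ T.Countable := by
    intro hTc
    refine hcov (f '' T) (hTc.image f) ?_
    rintro _ ⟨x, rfl⟩
    simp only [mem_iUnion, Metric.mem_closedBall, exists_prop, mem_image, exists_exists_and_eq_and]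
    by_contra! hx
    have : insert x T ⊆ T := hT.2 (hTs.insert fun y hy _ =>
      ⟨hx y hy, by rw [dist_comm]; exact hx y hy⟩) (subset_insert x T)
    exact (hx x (this (mem_insert _ _))).not_ge (by simpa using hε.le)
  have hinj : InjOn f T := fun x hx y hy hxy => by
    by_contra hne
    exact (hTs hx hy hne).not_ge (by simpa [hxy] using hε.le)
  have hclosed : ∀ A ⊆ T, IsClosed (f '' A) := by
    intro A hA
    refine Metric.isClosed_of_pairwise_le_dist hε ?_
    rintro _ ⟨x, hx, rfl⟩ _ ⟨y, hy, rfl⟩ hxy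
    exact hTs (hA hx) (hA hy) (by rintro rfl; exact hxy rfl) |>.le
  have hmeas : ∀ A ⊆ T, MeasurableSet (f ⁻¹' (f '' A)) := fun A hA =>
    hf (hclosed A hA).measurableSet
  -- Separated sets are closed, so distinct subsets of `T` give distinct Borel sets of `X`, and a
  -- countably generated σ-algebra has at most `𝔠` members.
  have hcard : (2 : Cardinal.{u}) ^ #T ≤ 𝔠 := by
    have h1 : #{s : Set X | MeasurableSet s} ≤ 𝔠 := by
      have := MeasurableSpace.cardinal_measurableSet_le_continuum
        (s := MeasurableSpace.countableGeneratingSet X)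
        ((MeasurableSpace.countable_countableGeneratingSet (α := X)).le_aleph0.trans
          aleph0_le_continuum)
      rwa [MeasurableSpace.generateFrom_countableGeneratingSet] at this
    rw [← mk_set]
    refine le_trans (mk_le_of_injective (f := fun A : Set T =>
      (⟨f ⁻¹' (f '' ((↑) '' A : Set X)), hmeas _ (by simp)⟩ : {s : Set X | MeasurableSet s})) ?_) h1
    have aux : ∀ A B : Set T, f ⁻¹' (f '' ((↑) '' A : Set X)) = f ⁻¹' (f '' ((↑) '' B : Set X)) →
        A ⊆ B := by
      intro A B hAB x hx
      have : (x : X) ∈ f ⁻¹' (f '' ((↑) '' B : Set X)) := hAB ▸ ⟨x, ⟨x, hx, rfl⟩, rfl⟩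
      obtain ⟨_, ⟨y, hy, rfl⟩, hyx⟩ := this
      rwa [← Subtype.ext (hinj y.2 x.2 hyx)]
    intro A B hAB
    have hAB' := congrArg Subtype.val hAB
    exact (aux A B hAB').antisymm (aux B A hAB'.symm)
  obtain ⟨e, he⟩ : ∃ e : T → ℝ, Injective e := by
    have : lift.{0} #T ≤ lift.{u} #ℝ := by
      rw [mk_real, lift_continuum, lift_uzero]
      exact (cantor _).le.trans hcard
    obtain ⟨e⟩ := lift_mk_le'.1 this
    exact ⟨e, e.injective⟩
  obtain ⟨t₀, ht₀⟩ : T.Nonempty := by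
    by_contra hne
    exact hTc (by simp [not_nonempty_iff_eq_empty.1 hne])
  classical
  -- `s` collapses the fibre over each `f t` to `t` and everything else to `t₀`. All its preimages
  -- are Borel, so `e ∘ s` is Borel whatever the injection `e` is.
  let s : X → T := fun x => if hx : ∃ t : T, f t = f x then hx.choose else ⟨t₀, ht₀⟩
  have hs : ∀ t : T, s t = t := fun t => by
    have hx : ∃ t' : T, f t' = f t := ⟨t, rfl⟩
    simp only [s, dif_pos hx]
    exact Subtype.ext (hinj hx.choose.2 t.2 hx.choose_spec)
  have hs' : ∀ x (t : T), f t = f x → s x = t := fun x t ht => by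
    have hx : ∃ t' : T, f t' = f x := ⟨t, ht⟩
    simp only [s, dif_pos hx]
    exact Subtype.ext (hinj hx.choose.2 t.2 (hx.choose_spec.trans ht.symm))
  have hsm : ∀ A : Set T, MeasurableSet (s ⁻¹' A) := by
    intro A
    have h1 := hmeas ((↑) '' A) (by simp)
    have h2 := (hmeas T subset_rfl).compl
    have hmem : ∀ x, x ∉ f ⁻¹' (f '' T) → s x = ⟨t₀, ht₀⟩ := fun x hx =>
      dif_neg fun ⟨t, ht⟩ => hx ⟨t, t.2, ht⟩
    by_cases h0 : (⟨t₀, ht₀⟩ : T) ∈ A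
    · convert h1.union h2 using 1
      ext x
      by_cases hx : x ∈ f ⁻¹' (f '' T)
      · obtain ⟨t, ht, htx⟩ := hx
        have hxT : x ∈ f ⁻¹' (f '' T) := ⟨t, ht, htx⟩
        simp only [mem_preimage, hs' x ⟨t, ht⟩ htx, mem_union, mem_compl_iff, hxT, not_true,
          or_false]
        refine ⟨fun h => ⟨t, ⟨⟨t, ht⟩, h, rfl⟩, htx⟩, ?_⟩
        rintro ⟨_, ⟨t', ht', rfl⟩, h⟩
        rwa [← (Subtype.ext (hinj t'.2 ht (h.trans htx.symm)) : t' = ⟨t, ht⟩)]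
      · simp [hmem x hx, h0, hx]
    · convert h1 using 1
      ext x
      by_cases hx : x ∈ f ⁻¹' (f '' T)
      · obtain ⟨t, ht, htx⟩ := hx
        simp only [mem_preimage, hs' x ⟨t, ht⟩ htx]
        refine ⟨fun h => ⟨t, ⟨⟨t, ht⟩, h, rfl⟩, htx⟩, ?_⟩
        rintro ⟨_, ⟨t', ht', rfl⟩, h⟩
        rwa [← (Subtype.ext (hinj t'.2 ht (h.trans htx.symm)) : t' = ⟨t, ht⟩)]
      · simp only [mem_preimage, hmem x hx, h0, false_iff]
        rintro ⟨_, ⟨t', ht', rfl⟩, h⟩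
        exact hx ⟨t', t'.2, h⟩
  have hem : Measurable (e ∘ s) := fun A _ => hsm (e ⁻¹' A)
  -- In a finer Polish topology `e ∘ s` is continuous with uncountable range, so a Cantor set
  -- injects into `T`. Then `2 ^ #T ≤ 𝔠 ≤ #T`, against Cantor's theorem.
  obtain ⟨τ, -, hτc, hτ⟩ := hem.exists_continuous
  have hunc : ¬ (range (e ∘ s)).Countable := by
    intro hcount
    have : (range e).Countable := hcount.mono (by rintro _ ⟨t, rfl⟩; exact ⟨t, by simp [hs]⟩)
    have : Countable T := by
      have := this.to_subtype
      exact (rangeFactorization_injective.2 he).countable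
    exact hTc (countable_coe_iff.1 this)
  obtain ⟨g, hg⟩ := @Continuous.exists_nat_bool_injective_comp X ℝ τ hτ _ _ _ hτc hunc
  have hle : 𝔠 ≤ #T := by
    have hsg : Injective (s ∘ g) := fun x y hxy => hg (congrArg e hxy)
    have := lift_mk_le_lift_mk_of_injective hsg
    simpa using this
  exact (cantor #T).not_ge (hcard.trans hle)

/-- A Borel map from a Polish space to a metric space is strongly measurable. -/
theorem Measurable.stronglyMeasurable_of_polishSpace {X : Type u} {Y : Type v} [TopologicalSpace X]
    [PolishSpace X] [MeasurableSpace X] [BorelSpace X] [MetricSpace Y] [MeasurableSpace Y]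
    [BorelSpace Y] {f : X → Y} (hf : Measurable f) : StronglyMeasurable f :=
  stronglyMeasurable_iff_measurable_separable.2 ⟨hf, isSeparable_range_of_measurable hf⟩

/-! ### Finite ℓ² norms -/

/-- The `ℓ²` norm of a finite family of extended nonnegative reals. -/
noncomputable def ENNReal.l2Norm {I : Type*} [Fintype I] (a : I → ℝ≥0∞) : ℝ≥0∞ :=
  (∑ c, a c ^ 2) ^ (1 / 2 : ℝ)

namespace ENNReal

variable {I : Type*} [Fintype I]

theorem l2Norm_mono {a b : I → ℝ≥0∞} (h : ∀ c, a c ≤ b c) : l2Norm a ≤ l2Norm b := by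
  unfold l2Norm
  gcongr with c
  exact h c

theorem l2Norm_add_le (a b : I → ℝ≥0∞) :
    l2Norm (fun c => a c + b c) ≤ l2Norm a + l2Norm b := by
  have := ENNReal.Lp_add_le Finset.univ a b (p := 2) (by norm_num)
  simpa [l2Norm] using this

theorem l2Norm_eq_zero {a : I → ℝ≥0∞} : l2Norm a = 0 ↔ ∀ c, a c = 0 := by
  simp [l2Norm, ENNReal.rpow_eq_zero_iff]

theorem l2Norm_lt_top {a : I → ℝ≥0∞} (h : ∀ c, a c < ∞) : l2Norm a < ∞ := by
  refine ENNReal.rpow_lt_top_of_nonneg (by norm_num) (ENNReal.sum_lt_top.2 fun c _ => ?_).ne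
  exact ENNReal.pow_lt_top (h c)

theorem le_l2Norm (a : I → ℝ≥0∞) (c : I) : a c ≤ l2Norm a := by
  have h : a c ^ 2 ≤ ∑ c, a c ^ 2 :=
    Finset.single_le_sum (f := fun c => a c ^ 2) (by simp) (Finset.mem_univ c)
  calc a c = (a c ^ 2) ^ (1 / 2 : ℝ) := by
        rw [← ENNReal.rpow_natCast, ← ENNReal.rpow_mul]; norm_num
    _ ≤ l2Norm a := by unfold l2Norm; gcongr

theorem tendsto_l2Norm_zero {α : Type*} {l : Filter α} {a : α → I → ℝ≥0∞}
    (h : ∀ c, Filter.Tendsto (fun n => a n c) l (nhds 0)) :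
    Filter.Tendsto (fun n => l2Norm (a n)) l (nhds 0) := by
  have h1 : Filter.Tendsto (fun n => ∑ c, a n c ^ 2) l (nhds (∑ _c : I, 0)) :=
    tendsto_finsetSum _ fun c _ => by
      simpa [Function.comp_def] using ((ENNReal.continuous_pow 2).tendsto 0).comp (h c)
  have h2 := (ENNReal.continuous_rpow_const (y := 1 / 2)).tendsto (∑ _c : I, (0 : ℝ≥0∞))
  have := h2.comp h1
  simpa [l2Norm, Function.comp_def] using this

end ENNReal

/-! ### Block decomposition of kernels on the disjoint union -/

namespace PartitionedNetwork

variable {k : ℕ} (P : PartitionedNetwork.{u} k)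

/-- The restriction of the kernel of a network to a pair of classes. -/
def kernel (i j : Fin k) (z : P.X i × P.X j) : ℝ := P.ω ⟨i, z.1⟩ ⟨j, z.2⟩

end PartitionedNetwork

section Sigma

variable {k : ℕ} {X : Fin k → Type u} [∀ i, MeasurableSpace (X i)]

theorem measurableSet_sigma_iff {s : Set (Σ i, X i)} :
    MeasurableSet s ↔ ∀ i, MeasurableSet ((fun x : X i => (⟨i, x⟩ : Σ i, X i)) ⁻¹' s) :=
  MeasurableSpace.measurableSet_iInf

theorem measurableEmbedding_sigmaMk (i : Fin k) :
    MeasurableEmbedding (fun x : X i => (⟨i, x⟩ : Σ i, X i)) where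
  injective := sigma_mk_injective
  measurable := fun _ hs => measurableSet_sigma_iff.1 hs i
  measurableSet_image' := by
    intro s hs
    rw [measurableSet_sigma_iff]
    intro j
    rcases eq_or_ne i j with rfl | hij
    · convert hs using 1
      exact Set.preimage_image_eq s sigma_mk_injective
    · convert MeasurableSet.empty using 1
      ext x
      simp only [Set.mem_preimage, Set.mem_image, Sigma.mk.injEq, Set.mem_empty_iff_false, iff_false]
      rintro ⟨y, -, h, -⟩
      exact hij h

theorem prod_sum_map_sigmaMk (μ : ∀ i, Measure (X i)) [∀ i, IsProbabilityMeasure (μ i)] :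
    (∑ i, (μ i).map (fun x => (⟨i, x⟩ : Σ i, X i))).prod
      (∑ i, (μ i).map (fun x => (⟨i, x⟩ : Σ i, X i))) =
    Measure.sum fun p : Fin k × Fin k => ((μ p.1).prod (μ p.2)).map
      (Prod.map (fun x => (⟨p.1, x⟩ : Σ i, X i)) (fun x => (⟨p.2, x⟩ : Σ i, X i))) := by
  have hm : ∀ i, Measurable (fun x : X i => (⟨i, x⟩ : Σ i, X i)) :=
    fun i => (measurableEmbedding_sigmaMk i).measurable
  have := fun i => Measure.isProbabilityMeasure_map (μ := μ i) (hm i).aemeasurable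
  rw [← Measure.sum_fintype, Measure.prod_sum]
  congr 1
  ext1 p
  rw [Measure.map_prod_map _ _ (hm _) (hm _)]

theorem memLp_two_sum_measure_iff {α I : Type*} [MeasurableSpace α] [Fintype I]
    {m : I → Measure α} {f : α → ℝ} :
    MemLp f 2 (Measure.sum m) ↔ ∀ i, MemLp f 2 (m i) := by
  simp only [MemLp, aestronglyMeasurable_sum_measure_iff, forall_and]
  refine and_congr_right fun _ => ?_
  simp only [eLpNorm_lt_top_iff_lintegral_rpow_enorm_lt_top (p := 2) two_ne_zero
    ENNReal.ofNat_ne_top, lintegral_sum_measure, tsum_fintype, ENNReal.sum_lt_top,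
    Finset.mem_univ, true_implies]

/-- The squared measure on the disjoint union is the finite sum of the images of the products `(μ
i).prod (μ j)`, so square integrability can be tested block by block. -/
theorem memLp_two_sigma_iff (μ : ∀ i, Measure (X i)) [∀ i, IsProbabilityMeasure (μ i)]
    (ω : (Σ i, X i) → (Σ i, X i) → ℝ) :
    MemLp (fun z : (Σ i, X i) × (Σ i, X i) => ω z.1 z.2) 2
      ((∑ i, (μ i).map (fun x => (⟨i, x⟩ : Σ i, X i))).prod
        (∑ i, (μ i).map (fun x => (⟨i, x⟩ : Σ i, X i)))) ↔
    ∀ i j, MemLp (fun z : X i × X j => ω ⟨i, z.1⟩ ⟨j, z.2⟩) 2 ((μ i).prod (μ j)) := by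
  rw [prod_sum_map_sigmaMk, memLp_two_sum_measure_iff, Prod.forall]
  refine forall₂_congr fun i j => ?_
  rw [((measurableEmbedding_sigmaMk i).prodMap
    (measurableEmbedding_sigmaMk j)).memLp_map_measure_iff]
  rfl

end Sigma

theorem PartitionedNetwork.kernel_memLp {k : ℕ} (P : PartitionedNetwork.{u} k) (i j : Fin k) :
    MemLp (P.kernel i j) 2 ((P.μ i).prod (P.μ j)) :=
  (memLp_two_sigma_iff P.μ P.ω).1 P.ω_memLp i j

/-! ### Discrepancies on a common probability space -/

namespace LabelledNetwork

variable {k : ℕ} {Λ : Fin k → Type v} [∀ i, NormedAddCommGroup (Λ i)]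
  [∀ i, MeasurableSpace (Λ i)] [∀ i, BorelSpace (Λ i)]

theorem label_stronglyMeasurable (L : LabelledNetwork.{u, v} k Λ) (i : Fin k) :
    StronglyMeasurable (L.ι i) :=
  (L.ι_measurable i).stronglyMeasurable_of_polishSpace

/-- By Tonelli some `y` makes `x ↦ dist (ι x) (ι y)` square integrable. Adding back the constant `ι
y` is harmless on a probability space. -/
theorem label_memLp (L : LabelledNetwork.{u, v} k Λ) (i : Fin k) :
    MemLp (L.ι i) 2 (L.μ i) := by
  have h := (L.ι_memLp i).2
  rw [eLpNorm_lt_top_iff_lintegral_rpow_enorm_lt_top two_ne_zero ENNReal.ofNat_ne_top] at h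
  have hm : StronglyMeasurable fun z : L.X i × L.X i => dist (L.ι i z.1) (L.ι i z.2) :=
    ((L.label_stronglyMeasurable i).comp_measurable measurable_fst).dist
      ((L.label_stronglyMeasurable i).comp_measurable measurable_snd)
  rw [lintegral_prod_symm _ (hm.enorm.pow_const _).aemeasurable] at h
  have hne : (∫⁻ y, ∫⁻ x, ‖dist (L.ι i x) (L.ι i y)‖ₑ ^ (2 : ℝ≥0∞).toReal ∂L.μ i ∂L.μ i) ≠ ∞ :=
    h.ne
  obtain ⟨y, hy⟩ := (ae_lt_top' (by
    exact ((hm.enorm.pow_const _).lintegral_prod_left').aemeasurable) hne).exists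
  have h2 : MemLp (fun x => L.ι i x - L.ι i y) 2 (L.μ i) := by
    refine ⟨((L.label_stronglyMeasurable i).sub stronglyMeasurable_const).aestronglyMeasurable, ?_⟩
    rw [eLpNorm_lt_top_iff_lintegral_rpow_enorm_lt_top two_ne_zero ENNReal.ofNat_ne_top]
    convert hy using 5 with x
    rw [dist_eq_norm, enorm_norm]
  have h3 := h2.add (memLp_const (L.ι i y))
  have : (fun x => L.ι i x - L.ι i y) + (fun _ => L.ι i y) = L.ι i := by ext x; simp
  rwa [this] at h3

section Pullback

variable {Ω : Fin k → Type*} [∀ i, MeasurableSpace (Ω i)]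

/-- The summands of the cost of two networks whose node spaces are both images of
spaces `(Ω i, m i)`. -/
noncomputable def pullbackDiscrepancy (L L' : LabelledNetwork.{u, v} k Λ) (m : ∀ i, Measure (Ω i))
    (a : ∀ i, Ω i → L.X i) (a' : ∀ i, Ω i → L'.X i) : (Fin k × Fin k) ⊕ Fin k → ℝ≥0∞
  | Sum.inl p => eLpNorm (L.kernel p.1 p.2 ∘ Prod.map (a p.1) (a p.2) -
      L'.kernel p.1 p.2 ∘ Prod.map (a' p.1) (a' p.2)) 2 ((m p.1).prod (m p.2))
  | Sum.inr i => eLpNorm (L.ι i ∘ a i - L'.ι i ∘ a' i) 2 (m i)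

theorem cost_eq (L L' : LabelledNetwork.{u, v} k Λ) (π : ∀ i, Measure (L.X i × L'.X i)) :
    cost L L' π = 1 / 2 * ENNReal.l2Norm
      (pullbackDiscrepancy L L' π (fun _ => Prod.fst) (fun _ => Prod.snd)) := by
  rw [cost, ENNReal.l2Norm, Fintype.sum_sum_type, Fintype.sum_prod_type]
  congr! 6
  rename_i i _
  rw [pullbackDiscrepancy, ← eLpNorm_norm (L.ι i ∘ Prod.fst - L'.ι i ∘ Prod.snd)]
  congr! 2 with z
  exact dist_eq_norm _ _

variable {L L' L'' : LabelledNetwork.{u, v} k Λ} {m : ∀ i, Measure (Ω i)}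
  {a : ∀ i, Ω i → L.X i} {a' : ∀ i, Ω i → L'.X i} {a'' : ∀ i, Ω i → L''.X i}

theorem kernel_comp_memLp [∀ i, IsProbabilityMeasure (m i)]
    (ha : ∀ i, MeasurePreserving (a i) (m i) (L.μ i)) (i j : Fin k) :
    MemLp (L.kernel i j ∘ Prod.map (a i) (a j)) 2 ((m i).prod (m j)) :=
  (L.kernel_memLp i j).comp_measurePreserving ((ha i).prod (ha j))

theorem label_comp_memLp (ha : ∀ i, MeasurePreserving (a i) (m i) (L.μ i)) (i : Fin k) :
    MemLp (L.ι i ∘ a i) 2 (m i) :=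
  (L.label_memLp i).comp_measurePreserving (ha i)

theorem pullbackDiscrepancy_lt_top [∀ i, IsProbabilityMeasure (m i)]
    (ha : ∀ i, MeasurePreserving (a i) (m i) (L.μ i))
    (ha' : ∀ i, MeasurePreserving (a' i) (m i) (L'.μ i)) (c) :
    pullbackDiscrepancy L L' m a a' c < ∞ := by
  rcases c with ⟨i, j⟩ | i
  · exact ((kernel_comp_memLp ha i j).sub (kernel_comp_memLp ha' i j)).2
  · exact ((label_comp_memLp ha i).sub (label_comp_memLp ha' i)).2

theorem pullbackDiscrepancy_comm (c) :
    pullbackDiscrepancy L L' m a a' c = pullbackDiscrepancy L' L m a' a c := by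
  rcases c with ⟨i, j⟩ | i
  · exact eLpNorm_sub_comm _ _ _ _
  · exact eLpNorm_sub_comm _ _ _ _

theorem pullbackDiscrepancy_triangle [∀ i, IsProbabilityMeasure (m i)]
    (ha : ∀ i, MeasurePreserving (a i) (m i) (L.μ i))
    (ha' : ∀ i, MeasurePreserving (a' i) (m i) (L'.μ i))
    (ha'' : ∀ i, MeasurePreserving (a'' i) (m i) (L''.μ i)) (c) :
    pullbackDiscrepancy L L'' m a a'' c ≤
      pullbackDiscrepancy L L' m a a' c + pullbackDiscrepancy L' L'' m a' a'' c := by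
  rcases c with ⟨i, j⟩ | i
  · have h := kernel_comp_memLp ha i j
    have h' := kernel_comp_memLp ha' i j
    have h'' := kernel_comp_memLp ha'' i j
    rw [pullbackDiscrepancy, ← sub_add_sub_cancel _ (L'.kernel i j ∘ Prod.map (a' i) (a' j)) _]
    exact eLpNorm_add_le (h.1.sub h'.1) (h'.1.sub h''.1) one_le_two
  · have h := label_comp_memLp ha i
    have h' := label_comp_memLp ha' i
    have h'' := label_comp_memLp ha'' i
    rw [pullbackDiscrepancy, ← sub_add_sub_cancel _ (L'.ι i ∘ a' i) _]
    exact eLpNorm_add_le (h.1.sub h'.1) (h'.1.sub h''.1) one_le_two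

theorem pullbackDiscrepancy_comp {Ω' : Fin k → Type*} [∀ i, MeasurableSpace (Ω' i)]
    [∀ i, IsProbabilityMeasure (m i)] {m' : ∀ i, Measure (Ω' i)} [∀ i, IsProbabilityMeasure (m' i)]
    {b : ∀ i, Ω' i → Ω i}
    (hb : ∀ i, MeasurePreserving (b i) (m' i) (m i))
    (ha : ∀ i, MeasurePreserving (a i) (m i) (L.μ i))
    (ha' : ∀ i, MeasurePreserving (a' i) (m i) (L'.μ i)) (c) :
    pullbackDiscrepancy L L' m' (fun i => a i ∘ b i) (fun i => a' i ∘ b i) c =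
      pullbackDiscrepancy L L' m a a' c := by
  rcases c with ⟨i, j⟩ | i
  · exact eLpNorm_comp_measurePreserving (f := Prod.map (b i) (b j))
      (g := L.kernel i j ∘ Prod.map (a i) (a j) - L'.kernel i j ∘ Prod.map (a' i) (a' j))
      ((kernel_comp_memLp ha i j).sub (kernel_comp_memLp ha' i j)).1 ((hb i).prod (hb j))
  · exact eLpNorm_comp_measurePreserving
      ((label_comp_memLp ha i).sub (label_comp_memLp ha' i)).1 (hb i)

/-- The joint law of `a i` and `a' i` is a coupling, and `L²` norms are unchanged by passing to it.
Hence any common source, not only a product, yields an upper bound. -/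
theorem networkDist_le [∀ i, IsProbabilityMeasure (m i)]
    (ha : ∀ i, MeasurePreserving (a i) (m i) (L.μ i))
    (ha' : ∀ i, MeasurePreserving (a' i) (m i) (L'.μ i)) :
    networkDist L L' ≤ 1 / 2 * ENNReal.l2Norm (pullbackDiscrepancy L L' m a a') := by
  have hb : ∀ i, MeasurePreserving (fun w => (a i w, a' i w)) (m i)
      ((m i).map fun w => (a i w, a' i w)) := fun i =>
    ((ha i).measurable.prodMk (ha' i).measurable).measurePreserving _
  have h1 : ∀ i, ((m i).map fun w => (a i w, a' i w)).map Prod.fst = L.μ i := fun i => by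
    rw [Measure.map_map measurable_fst (hb i).measurable]
    exact (ha i).map_eq
  have h2 : ∀ i, ((m i).map fun w => (a i w, a' i w)).map Prod.snd = L'.μ i := fun i => by
    rw [Measure.map_map measurable_snd (hb i).measurable]
    exact (ha' i).map_eq
  have := fun i => Measure.isProbabilityMeasure_map (μ := m i) (hb i).measurable.aemeasurable
  refine (iInf₂_le (fun i => (m i).map fun w => (a i w, a' i w))
    fun i => ⟨h1 i, h2 i⟩).trans_eq ?_
  rw [cost_eq]
  congr 2
  ext c
  exact (pullbackDiscrepancy_comp hb (fun i => ⟨measurable_fst, h1 i⟩)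
    (fun i => ⟨measurable_snd, h2 i⟩) c).symm

end Pullback

variable {L L' L'' : LabelledNetwork.{u, v} k Λ}

theorem isProbabilityMeasure_of_mem_couplings {A B : Type u} [MeasurableSpace A]
    [MeasurableSpace B] {μ : Measure A} {ν : Measure B} [IsProbabilityMeasure μ]
    {π : Measure (A × B)} (h : π ∈ couplings μ ν) : IsProbabilityMeasure π := by
  have : IsProbabilityMeasure (π.map Prod.fst) := h.1 ▸ inferInstance
  exact Measure.isProbabilityMeasure_of_map Prod.fst

theorem exists_couplings_cost_lt {r : ℝ≥0∞} (h : networkDist L L' < r) :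
    ∃ π : ∀ i, Measure (L.X i × L'.X i), (∀ i, IsProbabilityMeasure (π i)) ∧
      (∀ i, MeasurePreserving Prod.fst (π i) (L.μ i)) ∧
      (∀ i, MeasurePreserving Prod.snd (π i) (L'.μ i)) ∧
      1 / 2 * ENNReal.l2Norm
        (pullbackDiscrepancy L L' π (fun _ => Prod.fst) (fun _ => Prod.snd)) < r := by
  simp only [networkDist, iInf_lt_iff] at h
  obtain ⟨π, hπ, hlt⟩ := h
  exact ⟨π, fun i => isProbabilityMeasure_of_mem_couplings (hπ i),
    fun i => ⟨measurable_fst, (hπ i).1⟩,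
    fun i => ⟨measurable_snd, (hπ i).2⟩, by rwa [← cost_eq]⟩

theorem networkDist_self (L : LabelledNetwork.{u, v} k Λ) : networkDist L L = 0 := by
  refine le_antisymm ((networkDist_le (m := L.μ) (a := fun _ => id) (a' := fun _ => id)
    (fun i => .id _) (fun i => .id _)).trans_eq ?_) zero_le
  rw [ENNReal.l2Norm_eq_zero.2, mul_zero]
  rintro (⟨i, j⟩ | i) <;> simp [pullbackDiscrepancy]

theorem networkDist_comm_le (L L' : LabelledNetwork.{u, v} k Λ) :
    networkDist L L' ≤ networkDist L' L := by
  refine le_of_forall_gt fun r hr => ?_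
  obtain ⟨π, hp, h1, h2, hlt⟩ := exists_couplings_cost_lt hr
  refine (networkDist_le h2 h1).trans_lt ?_
  rwa [show pullbackDiscrepancy L L' π (fun _ => Prod.snd) (fun _ => Prod.fst) = _ from
    funext pullbackDiscrepancy_comm]

theorem networkDist_comm (L L' : LabelledNetwork.{u, v} k Λ) :
    networkDist L L' = networkDist L' L :=
  (networkDist_comm_le L L').antisymm (networkDist_comm_le L' L)

theorem networkDist_lt_top (L L' : LabelledNetwork.{u, v} k Λ) : networkDist L L' < ∞ := by
  refine (networkDist_le (m := fun i => (L.μ i).prod (L'.μ i)) (fun i => measurePreserving_fst)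
    (fun i => measurePreserving_snd)).trans_lt (ENNReal.mul_lt_top (by simp) ?_)
  exact ENNReal.l2Norm_lt_top
    (pullbackDiscrepancy_lt_top (fun i => measurePreserving_fst) (fun i => measurePreserving_snd))

end LabelledNetwork

/-! ### Gluing and the triangle inequality -/

open ProbabilityTheory in
/-- The gluing lemma: two couplings with a common marginal are marginals of one measure. -/
theorem exists_gluing {X : Type*} {Y : Type*} {Z : Type*} [MeasurableSpace X] [MeasurableSpace Y]
    [MeasurableSpace Z] [StandardBorelSpace X] [StandardBorelSpace Z]
    {π : Measure (X × Y)} {ρ : Measure (Y × Z)} [IsProbabilityMeasure π] [IsProbabilityMeasure ρ]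
    (h : π.map Prod.snd = ρ.map Prod.fst) :
    ∃ m : Measure (Y × X × Z), IsProbabilityMeasure m ∧
      MeasurePreserving (fun w => (w.2.1, w.1)) m π ∧
      MeasurePreserving (fun w => (w.1, w.2.2)) m ρ := by
  have : Nonempty X := (nonempty_of_isProbabilityMeasure π).map Prod.fst
  have : Nonempty Z := (nonempty_of_isProbabilityMeasure ρ).map Prod.snd
  have := Measure.isProbabilityMeasure_map (μ := π) measurable_swap.aemeasurable
  set π' := π.map Prod.swap with hπ'
  have hfst : π'.fst = ρ.fst := by
    rw [Measure.fst, hπ', Measure.map_map measurable_fst measurable_swap, Measure.fst, ← h]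
    rfl
  -- Both couplings are disintegrated over the shared marginal, and the outer coordinates are made
  -- conditionally independent given the middle one.
  refine ⟨ρ.fst ⊗ₘ (π'.condKernel ×ₖ ρ.condKernel), inferInstance, ?_, ?_⟩
  · refine ⟨by fun_prop, ?_⟩
    have h1 : (ρ.fst ⊗ₘ (π'.condKernel ×ₖ ρ.condKernel)).map (Prod.map id Prod.fst) = π' := by
      rw [← Measure.compProd_map measurable_fst, ← Kernel.fst_eq, Kernel.fst_prod, ← hfst,
        Measure.disintegrate]
    have h2 : π'.map Prod.swap = π := by
      rw [hπ', Measure.map_map measurable_swap measurable_swap]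
      simp
    rw [← h1, Measure.map_map measurable_swap (by fun_prop)] at h2
    exact h2
  · refine ⟨by fun_prop, ?_⟩
    have h1 : (ρ.fst ⊗ₘ (π'.condKernel ×ₖ ρ.condKernel)).map (Prod.map id Prod.snd) = ρ := by
      rw [← Measure.compProd_map measurable_snd, ← Kernel.snd_eq, Kernel.snd_prod,
        Measure.disintegrate]
    exact h1

namespace LabelledNetwork

variable {k : ℕ} {Λ : Fin k → Type v} [∀ i, NormedAddCommGroup (Λ i)]
  [∀ i, MeasurableSpace (Λ i)] [∀ i, BorelSpace (Λ i)]

theorem networkDist_le_add {Ω : Fin k → Type*} [∀ i, MeasurableSpace (Ω i)]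
    {L L' L'' : LabelledNetwork.{u, v} k Λ} {m : ∀ i, Measure (Ω i)}
    [∀ i, IsProbabilityMeasure (m i)]
    {a : ∀ i, Ω i → L.X i} {a' : ∀ i, Ω i → L'.X i} {a'' : ∀ i, Ω i → L''.X i}
    (ha : ∀ i, MeasurePreserving (a i) (m i) (L.μ i))
    (ha' : ∀ i, MeasurePreserving (a' i) (m i) (L'.μ i))
    (ha'' : ∀ i, MeasurePreserving (a'' i) (m i) (L''.μ i)) :
    networkDist L L'' ≤ 1 / 2 * ENNReal.l2Norm (pullbackDiscrepancy L L' m a a') +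
      1 / 2 * ENNReal.l2Norm (pullbackDiscrepancy L' L'' m a' a'') := by
  rw [← mul_add]
  refine (networkDist_le ha ha'').trans ?_
  gcongr
  exact (ENNReal.l2Norm_mono (pullbackDiscrepancy_triangle ha ha' ha'')).trans
    (ENNReal.l2Norm_add_le _ _)

theorem networkDist_le_add_of_gluing {Ω : Fin k → Type*} [∀ i, MeasurableSpace (Ω i)]
    {L L' L'' : LabelledNetwork.{u, v} k Λ} {m : ∀ i, Measure (Ω i)}
    [∀ i, IsProbabilityMeasure (m i)]
    {π : ∀ i, Measure (L.X i × L'.X i)} [∀ i, IsProbabilityMeasure (π i)]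
    {ρ : ∀ i, Measure (L'.X i × L''.X i)} [∀ i, IsProbabilityMeasure (ρ i)]
    {b : ∀ i, Ω i → L.X i × L'.X i} {b' : ∀ i, Ω i → L'.X i × L''.X i}
    (hb : ∀ i, MeasurePreserving (b i) (m i) (π i))
    (hb' : ∀ i, MeasurePreserving (b' i) (m i) (ρ i))
    (h : ∀ i, Prod.fst ∘ b' i = Prod.snd ∘ b i)
    (h1 : ∀ i, MeasurePreserving Prod.fst (π i) (L.μ i))
    (h2 : ∀ i, MeasurePreserving Prod.snd (π i) (L'.μ i))
    (h1' : ∀ i, MeasurePreserving Prod.fst (ρ i) (L'.μ i))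
    (h2' : ∀ i, MeasurePreserving Prod.snd (ρ i) (L''.μ i)) :
    networkDist L L'' ≤
      1 / 2 * ENNReal.l2Norm
        (pullbackDiscrepancy L L' π (fun _ => Prod.fst) (fun _ => Prod.snd)) +
      1 / 2 * ENNReal.l2Norm
        (pullbackDiscrepancy L' L'' ρ (fun _ => Prod.fst) (fun _ => Prod.snd)) := by
  have key := networkDist_le_add (L := L) (L' := L') (L'' := L'')
    (fun i => (h1 i).comp (hb i)) (fun i => (h2 i).comp (hb i)) (fun i => (h2' i).comp (hb' i))
  have e1 := funext (pullbackDiscrepancy_comp hb h1 h2)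
  have e2 := funext (pullbackDiscrepancy_comp hb' h1' h2')
  simp only [h] at e2
  rwa [e1, e2] at key

theorem networkDist_triangle (L L' L'' : LabelledNetwork.{u, v} k Λ) :
    networkDist L L'' ≤ networkDist L L' + networkDist L' L'' := by
  refine ENNReal.le_of_forall_pos_le_add fun ε hε _ => ?_
  have hε' : (ε : ℝ≥0∞) / 2 ≠ 0 := by simpa using hε.ne'
  obtain ⟨π, hp, h1, h2, hlt⟩ := exists_couplings_cost_lt
    (ENNReal.lt_add_right (networkDist_lt_top L L').ne hε')
  obtain ⟨ρ, hp', h1', h2', hlt'⟩ := exists_couplings_cost_lt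
    (ENNReal.lt_add_right (networkDist_lt_top L' L'').ne hε')
  have hglue := fun i => exists_gluing ((h2 i).map_eq.trans (h1' i).map_eq.symm)
  choose m hm hmπ hmρ using hglue
  refine (networkDist_le_add_of_gluing hmπ hmρ (fun _ => rfl) h1 h2 h1' h2').trans ?_
  calc _ ≤ (networkDist L L' + ε / 2) + (networkDist L' L'' + ε / 2) := add_le_add hlt.le hlt'.le
    _ = networkDist L L' + networkDist L' L'' + ε := by
        rw [add_add_add_comm, ENNReal.add_halves]

end LabelledNetwork

/-! ### Compactness of couplings and networks at distance zero -/

open Filter Topology BoundedContinuousFunction in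
/-- Suppose that functions `f`, `f'` in `L²` are pulled back along continuous maps `p`, `p'` to
spaces with weakly convergent measures, all projecting to the same marginals. If the `L²` distance
of the pullbacks tends to `0`, it vanishes in the limit. -/
theorem eLpNorm_sub_eq_zero_of_tendsto {Z X X' E α : Type*}
    [TopologicalSpace Z] [MeasurableSpace Z] [OpensMeasurableSpace Z]
    [TopologicalSpace X] [TopologicalSpace.PseudoMetrizableSpace X] [MeasurableSpace X]
    [BorelSpace X] [TopologicalSpace X'] [TopologicalSpace.PseudoMetrizableSpace X']
    [MeasurableSpace X'] [BorelSpace X']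
    [NormedAddCommGroup E] [NormedSpace ℝ E] {l : Filter α} [l.NeBot]
    {P : α → ProbabilityMeasure Z} {Q : ProbabilityMeasure Z} (hPQ : Tendsto P l (𝓝 Q))
    {μ : Measure X} [IsProbabilityMeasure μ] {μ' : Measure X'} [IsProbabilityMeasure μ']
    {p : Z → X} {p' : Z → X'} (hp : Continuous p) (hp' : Continuous p')
    (hPp : ∀ n, MeasurePreserving p (P n : Measure Z) μ)
    (hQp : MeasurePreserving p (Q : Measure Z) μ)
    (hPp' : ∀ n, MeasurePreserving p' (P n : Measure Z) μ')
    (hQp' : MeasurePreserving p' (Q : Measure Z) μ')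
    {f : X → E} {f' : X' → E} (hf : MemLp f 2 μ) (hf' : MemLp f' 2 μ')
    (h : Tendsto (fun n => eLpNorm (f ∘ p - f' ∘ p') 2 (P n : Measure Z)) l (𝓝 0)) :
    eLpNorm (f ∘ p - f' ∘ p') 2 (Q : Measure Z) = 0 := by
  refine le_antisymm (ENNReal.le_of_forall_pos_le_add fun ε hε _ => ?_) zero_le
  have hε5 : (ε : ℝ≥0∞) / 5 ≠ 0 := by simpa using hε.ne'
  -- Five errors: `2 * δ` to replace `f`, `f'` by `g`, `g'` under `P n`, one `δ` from smallness for
  -- late `n`, and `2 * δ` to return under `Q`.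
  set δ : ℝ≥0∞ := (ε : ℝ≥0∞) / 5 with hδ
  obtain ⟨g, hg, hgm⟩ := hf.exists_boundedContinuous_eLpNorm_sub_le (by simp) hε5
  obtain ⟨g', hg', hgm'⟩ := hf'.exists_boundedContinuous_eLpNorm_sub_le (by simp) hε5
  have key : ∀ R : ProbabilityMeasure Z, MeasurePreserving p (R : Measure Z) μ →
      MeasurePreserving p' (R : Measure Z) μ' →
      eLpNorm (f ∘ p - f' ∘ p') 2 (R : Measure Z) ≤
        eLpNorm (g ∘ p - g' ∘ p') 2 (R : Measure Z) + 2 * δ ∧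
      eLpNorm (g ∘ p - g' ∘ p') 2 (R : Measure Z) ≤
        eLpNorm (f ∘ p - f' ∘ p') 2 (R : Measure Z) + 2 * δ := by
    intro R hR hR'
    have m1 := (hf.comp_measurePreserving hR).1
    have m2 := (hf'.comp_measurePreserving hR').1
    have m3 := (hgm.comp_measurePreserving hR).1
    have m4 := (hgm'.comp_measurePreserving hR').1
    have e1 : eLpNorm (f ∘ p - g ∘ p) 2 (R : Measure Z) ≤ δ :=
      (eLpNorm_comp_measurePreserving (hf.sub hgm).1 hR).trans_le hg
    have e2 : eLpNorm (f' ∘ p' - g' ∘ p') 2 (R : Measure Z) ≤ δ :=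
      (eLpNorm_comp_measurePreserving (hf'.sub hgm').1 hR').trans_le hg'
    constructor
    · have : f ∘ p - f' ∘ p' = (g ∘ p - g' ∘ p') + ((f ∘ p - g ∘ p) - (f' ∘ p' - g' ∘ p')) := by
        abel
      rw [this, two_mul]
      refine (eLpNorm_add_le (m3.sub m4) ((m1.sub m3).sub (m2.sub m4)) one_le_two).trans ?_
      gcongr
      exact (eLpNorm_sub_le (m1.sub m3) (m2.sub m4) one_le_two).trans (add_le_add e1 e2)
    · have : g ∘ p - g' ∘ p' = (f ∘ p - f' ∘ p') - ((f ∘ p - g ∘ p) - (f' ∘ p' - g' ∘ p')) := by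
        abel
      rw [this, two_mul]
      refine (eLpNorm_sub_le (m1.sub m2) ((m1.sub m3).sub (m2.sub m4)) one_le_two).trans ?_
      gcongr
      exact (eLpNorm_sub_le (m1.sub m3) (m2.sub m4) one_le_two).trans (add_le_add e1 e2)
  have hlim : Tendsto (fun n => eLpNorm (g ∘ p - g' ∘ p') 2 (P n : Measure Z)) l
      (𝓝 (eLpNorm (g ∘ p - g' ∘ p') 2 (Q : Measure Z))) := by
    -- The squared norm `H` of `G` is bounded and continuous, so weak convergence applies to its
    -- integral.
    let G : Z →ᵇ E := g.compContinuous ⟨p, hp⟩ - g'.compContinuous ⟨p', hp'⟩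
    let H : Z →ᵇ NNReal := G.normComp.nnrealPart * G.normComp.nnrealPart
    have hH : ∀ R : Measure Z, eLpNorm (g ∘ p - g' ∘ p') 2 R =
        (lintegral R fun z => H z) ^ (1 / 2 : ℝ) := by
      intro R
      rw [eLpNorm_eq_lintegral_rpow_enorm_toReal two_ne_zero (by simp)]
      simp only [ENNReal.toReal_ofNat, H]
      congr! 3 with z
      rw [show (2 : ℝ) = ((2 : ℕ) : ℝ) by norm_num, ENNReal.rpow_natCast, sq]
      change _ = ((Real.toNNReal ‖G z‖ * Real.toNNReal ‖G z‖ : NNReal) : ℝ≥0∞)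
      rw [norm_toNNReal]
      rfl
    simp only [hH]
    exact (ENNReal.continuous_rpow_const.tendsto _).comp
      (ProbabilityMeasure.tendsto_iff_forall_lintegral_tendsto.1 hPQ H)
  have hQ : eLpNorm (g ∘ p - g' ∘ p') 2 (Q : Measure Z) ≤ 3 * δ := by
    refine le_of_tendsto hlim ?_
    filter_upwards [h.eventually (gt_mem_nhds (pos_iff_ne_zero.2 hε5))] with n hn
    calc _ ≤ _ := (key (P n) (hPp n) (hPp' n)).2
      _ ≤ δ + 2 * δ := by gcongr
      _ = 3 * δ := by ring
  calc _ ≤ _ := (key Q hQp hQp').1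
    _ ≤ 3 * δ + 2 * δ := by gcongr
    _ = 5 * δ := by ring
    _ = 0 + ε := by rw [zero_add, hδ, ENNReal.mul_div_cancel (by simp) (by simp)]

/-- The couplings of two probability measures on Polish spaces form a compact set. -/
theorem isCompact_couplings {A B : Type u} [TopologicalSpace A] [PolishSpace A] [MeasurableSpace A]
    [BorelSpace A] [TopologicalSpace B] [PolishSpace B] [MeasurableSpace B] [BorelSpace B]
    (μ : ProbabilityMeasure A) (ν : ProbabilityMeasure B) :
    IsCompact {π : ProbabilityMeasure (A × B) |
      (π : Measure (A × B)) ∈ couplings (μ : Measure A) ν} := by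
  have hclosed : IsClosed
      {π : ProbabilityMeasure (A × B) | (π : Measure (A × B)) ∈ couplings (μ : Measure A) ν} := by
    have : {π : ProbabilityMeasure (A × B) | (π : Measure (A × B)) ∈ couplings (μ : Measure A) ν} =
        {π | π.map measurable_fst.aemeasurable = μ} ∩ {π | π.map measurable_snd.aemeasurable = ν} := by
      ext π
      simp only [Set.mem_inter_iff, Set.mem_ofPred_eq]
      exact ⟨fun h => ⟨Subtype.ext h.1, Subtype.ext h.2⟩,
        fun h => ⟨congrArg Subtype.val h.1, congrArg Subtype.val h.2⟩⟩
    rw [this]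
    exact (isClosed_eq (ProbabilityMeasure.continuous_map continuous_fst) continuous_const).inter
      (isClosed_eq (ProbabilityMeasure.continuous_map continuous_snd) continuous_const)
  rw [← hclosed.closure_eq]
  -- Prokhorov: each marginal is a single measure on a Polish space, hence tight, and tight
  -- marginals force tight couplings.
  refine isCompact_closure_of_isTightMeasureSet (IsTightMeasureSet.prodMk ?_ ?_)
  · refine (isTightMeasureSet_singleton (μ := (μ : Measure A))).subset ?_
    rintro _ ⟨_, ⟨π, hπ, rfl⟩, rfl⟩
    exact hπ.1
  · refine (isTightMeasureSet_singleton (μ := (ν : Measure B))).subset ?_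
    rintro _ ⟨_, ⟨π, hπ, rfl⟩, rfl⟩
    exact hπ.2

namespace LabelledNetwork

variable {k : ℕ} {Λ : Fin k → Type v} [∀ i, NormedAddCommGroup (Λ i)]
  [∀ i, MeasurableSpace (Λ i)] [∀ i, BorelSpace (Λ i)]

/-- The labelled network given by its kernels on pairs of classes. -/
def ofKernels (X : Fin k → Type u) [∀ i, TopologicalSpace (X i)] [∀ i, PolishSpace (X i)]
    [∀ i, MeasurableSpace (X i)] [∀ i, BorelSpace (X i)] (μ : ∀ i, Measure (X i))
    [∀ i, IsProbabilityMeasure (μ i)] (K : ∀ i j, X i × X j → ℝ) (hK : ∀ i j z, 0 ≤ K i j z)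
    (hKm : ∀ i j, MemLp (K i j) 2 ((μ i).prod (μ j))) (l : ∀ i, X i → Λ i)
    (hl : ∀ i, Measurable (l i)) (hlm : ∀ i, MemLp (l i) 2 (μ i)) :
    LabelledNetwork.{u, v} k Λ where
  X := X
  μ := μ
  ω x y := K x.1 y.1 (x.2, y.2)
  ω_nonneg _ _ := hK _ _ _
  ω_memLp := (memLp_two_sigma_iff μ fun x y => K x.1 y.1 (x.2, y.2)).2 hKm
  ι := l
  ι_measurable := hl
  ι_memLp i := by
    simp only [dist_eq_norm]
    exact (((hlm i).comp_measurePreserving measurePreserving_fst).sub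
      ((hlm i).comp_measurePreserving measurePreserving_snd)).norm

variable {L L' : LabelledNetwork.{u, v} k Λ}

theorem WeaklyIsomorphic.networkDist_eq_zero (h : L.WeaklyIsomorphic L') :
    networkDist L L' = 0 := by
  obtain ⟨M, φ, φ', hφ, hφ', hι⟩ := h
  refine le_antisymm ((networkDist_le hφ.measurePreserving hφ'.measurePreserving).trans_eq ?_)
    zero_le
  rw [ENNReal.l2Norm_eq_zero.2, mul_zero]
  rintro (⟨i, j⟩ | i)
  · refine (eLpNorm_congr_ae (g := 0) ?_).trans eLpNorm_zero
    filter_upwards [hφ.kernel_eq i j, hφ'.kernel_eq i j] with z hz hz'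
    exact sub_eq_zero.2 (hz.symm.trans hz')
  · refine (eLpNorm_congr_ae (g := 0) ?_).trans eLpNorm_zero
    filter_upwards [hι i] with x hx
    exact sub_eq_zero.2 (hx.1.symm.trans hx.2)

/-- The third network lives on the coupled spaces, with the data of `L` pulled back along the first
projection; zero discrepancy says that those of `L'` agree with it almost everywhere. -/
theorem weaklyIsomorphic_of_pullbackDiscrepancy_eq_zero
    {π : ∀ i, Measure (L.X i × L'.X i)} [∀ i, IsProbabilityMeasure (π i)]
    (h1 : ∀ i, MeasurePreserving Prod.fst (π i) (L.μ i))
    (h2 : ∀ i, MeasurePreserving Prod.snd (π i) (L'.μ i))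
    (h : ∀ c, pullbackDiscrepancy L L' π (fun _ => Prod.fst) (fun _ => Prod.snd) c = 0) :
    L.WeaklyIsomorphic L' := by
  refine ⟨ofKernels (fun i => L.X i × L'.X i) π
    (fun i j => L.kernel i j ∘ Prod.map Prod.fst Prod.fst) (fun _ _ _ => L.ω_nonneg _ _)
    (fun i j => kernel_comp_memLp h1 i j) (fun i => L.ι i ∘ Prod.fst)
    (fun i => (L.ι_measurable i).comp measurable_fst) (fun i => label_comp_memLp h1 i),
    fun i (z : L.X i × L'.X i) => z.1, fun i (z : L.X i × L'.X i) => z.2,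
    ⟨h1, fun i j => ae_of_all _ fun _ => rfl⟩,
    ⟨h2, fun i j => ?_⟩, fun i => ?_⟩
  · have h0 := h (Sum.inl (i, j))
    rw [pullbackDiscrepancy, eLpNorm_eq_zero_iff
      ((kernel_comp_memLp h1 i j).sub (kernel_comp_memLp h2 i j)).1 two_ne_zero] at h0
    filter_upwards [h0] with z hz
    exact sub_eq_zero.1 hz
  · have h0 := h (Sum.inr i)
    rw [pullbackDiscrepancy, eLpNorm_eq_zero_iff
      ((label_comp_memLp h1 i).sub (label_comp_memLp h2 i)).1 two_ne_zero] at h0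
    filter_upwards [h0] with z hz
    exact ⟨rfl, sub_eq_zero.1 hz⟩

open Filter Topology in
theorem weaklyIsomorphic_of_networkDist_eq_zero [∀ i, NormedSpace ℝ (Λ i)]
    (h : networkDist L L' = 0) : L.WeaklyIsomorphic L' := by
  have hex : ∀ n : ℕ, networkDist L L' < ((n : ℝ≥0∞) + 1)⁻¹ := fun n => by
    rw [h]; simp
  choose π hp h1 h2 hlt using fun n => exists_couplings_cost_lt (hex n)
  let Q : ℕ → ∀ i, ProbabilityMeasure (L.X i × L'.X i) := fun n i => ⟨π n i, hp n i⟩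
  have hcomp : IsCompact (Set.univ.pi fun i => {ρ : ProbabilityMeasure (L.X i × L'.X i) |
      (ρ : Measure (L.X i × L'.X i)) ∈ couplings (L.μ i) (L'.μ i)}) :=
    isCompact_univ_pi fun i => isCompact_couplings ⟨L.μ i, inferInstance⟩ ⟨L'.μ i, inferInstance⟩
  -- A nonprincipal ultrafilter replaces the extraction of a subsequence, for all classes at once.
  obtain ⟨R, hR, hQR⟩ := hcomp.ultrafilter_le_nhds ((hyperfilter ℕ).map Q)
    (by
      rw [le_principal_iff]
      exact Filter.mem_map.2 (univ_mem' fun n i _ => ⟨(h1 n i).map_eq, (h2 n i).map_eq⟩))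
  have hlim : Tendsto Q (hyperfilter ℕ) (𝓝 R) := hQR
  have hR1 : ∀ i, MeasurePreserving Prod.fst (R i : Measure (L.X i × L'.X i)) (L.μ i) :=
    fun i => ⟨measurable_fst, (hR i trivial).1⟩
  have hR2 : ∀ i, MeasurePreserving Prod.snd (R i : Measure (L.X i × L'.X i)) (L'.μ i) :=
    fun i => ⟨measurable_snd, (hR i trivial).2⟩
  have hlim0 : Tendsto (fun n : ℕ => ((n : ℝ≥0∞) + 1)⁻¹) atTop (𝓝 0) := by
    have := (tendsto_add_atTop_iff_nat 1).2 ENNReal.tendsto_inv_nat_nhds_zero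
    simpa using this
  have hdisc : ∀ c, Tendsto (fun n => pullbackDiscrepancy L L' (π n) (fun _ => Prod.fst)
      (fun _ => Prod.snd) c) (hyperfilter ℕ) (𝓝 0) := by
    intro c
    have h3 : Tendsto (fun n : ℕ => 2 * ((n : ℝ≥0∞) + 1)⁻¹) atTop (𝓝 0) := by
      simpa using ENNReal.Tendsto.const_mul hlim0 (Or.inr (by simp : (2 : ℝ≥0∞) ≠ ∞))
    refine tendsto_of_tendsto_of_tendsto_of_le_of_le tendsto_const_nhds
      (h3.mono_left Nat.hyperfilter_le_atTop) (fun _ => zero_le) fun n => ?_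
    refine (ENNReal.le_l2Norm _ c).trans ?_
    have := (hlt n).le
    calc _ = 2 * (1 / 2 * ENNReal.l2Norm
          (pullbackDiscrepancy L L' (π n) (fun _ => Prod.fst) (fun _ => Prod.snd))) := by
          rw [← mul_assoc, ENNReal.mul_div_cancel (by simp) (by simp), one_mul]
      _ ≤ _ := by gcongr
  refine weaklyIsomorphic_of_pullbackDiscrepancy_eq_zero (π := fun i => R i) hR1 hR2 ?_
  rintro (⟨i, j⟩ | i)
  · have hprod : Tendsto (fun n => (Q n i).prod (Q n j)) (hyperfilter ℕ)
        (𝓝 ((R i).prod (R j))) :=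
      (ProbabilityMeasure.continuous_prod.tendsto (R i, R j)).comp
        (((tendsto_pi_nhds.1 hlim i)).prodMk_nhds (tendsto_pi_nhds.1 hlim j))
    exact eLpNorm_sub_eq_zero_of_tendsto hprod (continuous_fst.prodMap continuous_fst)
      (continuous_snd.prodMap continuous_snd) (fun n => (h1 n i).prod (h1 n j))
      ((hR1 i).prod (hR1 j)) (fun n => (h2 n i).prod (h2 n j)) ((hR2 i).prod (hR2 j))
      (L.kernel_memLp i j) (L'.kernel_memLp i j) (hdisc (Sum.inl (i, j)))
  · exact eLpNorm_sub_eq_zero_of_tendsto (tendsto_pi_nhds.1 hlim i) continuous_fst continuous_snd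
      (fun n => h1 n i) (hR1 i) (fun n => h2 n i) (hR2 i) (L.label_memLp i) (L'.label_memLp i)
      (hdisc (Sum.inr i))

end LabelledNetwork

/-! ### Chaining couplings and convergence of fast Cauchy sequences -/

open ProbabilityTheory in
theorem MeasureTheory.Measure.map_compProd_comap {A B C : Type*} [MeasurableSpace A]
    [MeasurableSpace B] [MeasurableSpace C] (m : Measure A) [SFinite m] {g : A → B}
    (hg : Measurable g) (κ : Kernel B C) [IsSFiniteKernel κ] :
    (m ⊗ₘ κ.comap g hg).map (Prod.map g id) = (m.map g) ⊗ₘ κ := by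
  ext s hs
  rw [Measure.map_apply (by fun_prop) hs, Measure.compProd_apply (hs.preimage (by fun_prop)),
    Measure.compProd_apply hs, lintegral_map (Kernel.measurable_kernel_prodMk_left hs) hg]
  rfl

open ProbabilityTheory Finset Preorder in
/-- A sequence of couplings of consecutive spaces is realized by a measure on the product. -/
theorem exists_measure_pi_of_couplings {X : ℕ → Type*} [∀ n, MeasurableSpace (X n)]
    [∀ n, StandardBorelSpace (X n)] {μ : ∀ n, Measure (X n)} [∀ n, IsProbabilityMeasure (μ n)]
    {π : ∀ n, Measure (X n × X (n + 1))} [∀ n, IsProbabilityMeasure (π n)]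
    (h1 : ∀ n, MeasurePreserving Prod.fst (π n) (μ n))
    (h2 : ∀ n, MeasurePreserving Prod.snd (π n) (μ (n + 1))) :
    ∃ m : Measure (∀ n, X n), IsProbabilityMeasure m ∧
      ∀ n, MeasurePreserving (fun x => (x n, x (n + 1))) m (π n) := by
  have := fun n => nonempty_of_isProbabilityMeasure (μ n)
  have hev : ∀ n : ℕ, Measurable fun x : (∀ i : Iic n, X i) => x ⟨n, mem_Iic.2 le_rfl⟩ :=
    fun n => measurable_pi_apply _
  -- Each transition looks only at the last coordinate of the past, so the Ionescu-Tulcea measure is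
  -- a Markov chain whose consecutive pairs should have law `π n`.
  let κ : ∀ n, Kernel (∀ i : Iic n, X i) (X (n + 1)) := fun n => (π n).condKernel.comap _ (hev n)
  set m := Kernel.trajMeasure (μ 0) κ with hm
  have step : ∀ n, m.map (fun x => x n) = μ n → m.map (fun x => (x n, x (n + 1))) = π n := by
    intro n hn
    have h := Kernel.map_frestrictLe_trajMeasure_compProd_eq_map_trajMeasure (μ₀ := μ 0) (κ := κ)
      (a := n)
    have h' := congrArg (Measure.map (Prod.map (fun x => x ⟨n, mem_Iic.2 le_rfl⟩) id)) h
    rw [Measure.map_compProd_comap _ (hev n), Measure.map_map (hev n) (by fun_prop),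
      Measure.map_map (by fun_prop) (by fun_prop)] at h'
    change (m.map fun x => x n) ⊗ₘ _ = m.map (fun x => (x n, x (n + 1))) at h'
    rw [← h', hn, ← (h1 n).map_eq]
    exact (π n).disintegrate _
  have hmarg : ∀ n, m.map (fun x => x n) = μ n := by
    intro n
    induction n with
    | zero =>
      let e : X 0 ≃ᵐ (∀ i : Iic 0, X i) := (MeasurableEquiv.piUnique fun i : Iic 0 => X i).symm
      have h : m.map (frestrictLe 0) = (μ 0).map e := by
        rw [hm, Kernel.trajMeasure, Measure.map_comp _ _ (by fun_prop),
          Kernel.traj_map_frestrictLe, Kernel.partialTraj_self, Measure.id_comp]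
        rfl
      have h' := congrArg (Measure.map fun x => x ⟨0, mem_Iic.2 le_rfl⟩) h
      rw [Measure.map_map (hev 0) (by fun_prop), Measure.map_map (hev 0) e.measurable] at h'
      exact h'.trans Measure.map_id
    | succ n ih =>
      have := step n ih
      rw [← (h2 n).map_eq, ← this, Measure.map_map measurable_snd (by fun_prop)]
      rfl
  exact ⟨m, inferInstance, fun n => ⟨by fun_prop, step n (hmarg n)⟩⟩

-- This is completeness of `L²`. The strongly measurable representative is kept because a label map
-- must be Borel everywhere, not just almost everywhere.
open Filter Topology in
theorem exists_tendsto_eLpNorm_sub_of_le_geometric {α E : Type*} [MeasurableSpace α]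
    [NormedAddCommGroup E] [CompleteSpace E] {μ : Measure α} {f : ℕ → α → E}
    (hf : ∀ n, MemLp (f n) 2 μ) {C : ℝ≥0∞} (hC : C ≠ ∞)
    (h : ∀ n, eLpNorm (f n - f (n + 1)) 2 μ ≤ C / 2 ^ n) :
    ∃ g : α → E, StronglyMeasurable g ∧ MemLp g 2 μ ∧
      Tendsto (fun n => eLpNorm (f n - g) 2 μ) atTop (𝓝 0) := by
  have : Fact ((1 : ℝ≥0∞) ≤ 2) := ⟨one_le_two⟩
  have hc : CauchySeq fun n => (hf n).toLp (f n) :=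
    cauchySeq_of_edist_le_geometric_two C hC fun n => by
      rw [Lp.edist_toLp_toLp]
      exact h n
  obtain ⟨g, hg⟩ := cauchySeq_tendsto_of_complete hc
  refine ⟨g, Lp.stronglyMeasurable g, Lp.memLp g, ?_⟩
  rw [Lp.tendsto_Lp_iff_tendsto_eLpNorm'] at hg
  refine hg.congr fun n => eLpNorm_congr_ae ?_
  filter_upwards [(hf n).coeFn_toLp] with x hx
  simp [hx]

namespace LabelledNetwork

variable {k : ℕ} {Λ : Fin k → Type v} [∀ i, NormedAddCommGroup (Λ i)]
  [∀ i, MeasurableSpace (Λ i)] [∀ i, BorelSpace (Λ i)]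

open Filter Topology in
/-- If the distances of consecutive terms of a sequence of networks decay geometrically, the
sequence converges. -/
theorem exists_tendsto_networkDist [∀ i, CompleteSpace (Λ i)]
    (L : ℕ → LabelledNetwork.{u, v} k Λ)
    (h : ∀ n, networkDist (L n) (L (n + 1)) < (2 : ℝ≥0∞)⁻¹ ^ n) :
    ∃ M : LabelledNetwork.{u, v} k Λ, Tendsto (fun n => networkDist (L n) M) atTop (𝓝 0) := by
  choose π hp h1 h2 hlt using fun n => exists_couplings_cost_lt (h n)
  choose m hm hmπ using fun i => exists_measure_pi_of_couplings (X := fun n => (L n).X i)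
    (fun n => h1 n i) (fun n => h2 n i)
  -- A countable product of Polish spaces is Polish, so `Ω` can serve both as the common source of
  -- all the networks and as the node spaces of the limit.
  let Ω : Fin k → Type u := fun i => ∀ n, (L n).X i
  let a : ∀ n i, Ω i → (L n).X i := fun n i x => x n
  have ha : ∀ n i, MeasurePreserving (a n i) (m i) ((L n).μ i) := fun n i =>
    (h1 n i).comp (hmπ i n)
  have hdisc : ∀ n c, pullbackDiscrepancy (L n) (L (n + 1)) m (a n) (a (n + 1)) c ≤
      2 / 2 ^ n := by
    intro n c
    have e := pullbackDiscrepancy_comp (L := L n) (L' := L (n + 1)) (fun i => hmπ i n)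
      (h1 n) (h2 n) c
    refine (e.le.trans (ENNReal.le_l2Norm _ c)).trans ?_
    have := mul_le_mul_right (hlt n).le 2
    rwa [← mul_assoc, ENNReal.mul_div_cancel (by simp) (by simp), one_mul, ← ENNReal.inv_pow,
      ← div_eq_mul_inv] at this
  have hK : ∀ i j, ∃ K : Ω i × Ω j → ℝ, (∀ z, 0 ≤ K z) ∧ MemLp K 2 ((m i).prod (m j)) ∧
      Tendsto (fun n => eLpNorm ((L n).kernel i j ∘ Prod.map (a n i) (a n j) - K) 2
        ((m i).prod (m j))) atTop (𝓝 0) := by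
    intro i j
    obtain ⟨g, -, hg, hlim⟩ := exists_tendsto_eLpNorm_sub_of_le_geometric
      (fun n => kernel_comp_memLp (ha n) i j) (C := 2) (by simp) fun n => hdisc n (Sum.inl (i, j))
    -- The limit is only almost everywhere nonnegative; since the approximating kernels are
    -- nonnegative, taking the absolute value does not increase the distance to them.
    refine ⟨fun z => |g z|, fun z => abs_nonneg _, hg.norm, ?_⟩
    refine tendsto_of_tendsto_of_tendsto_of_le_of_le tendsto_const_nhds hlim
      (fun _ => zero_le) fun n => eLpNorm_mono fun z => ?_
    have h0 : 0 ≤ (L n).kernel i j (Prod.map (a n i) (a n j) z) := (L n).ω_nonneg _ _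
    have := abs_abs_sub_abs_le_abs_sub ((L n).kernel i j (Prod.map (a n i) (a n j) z)) (g z)
    rwa [abs_of_nonneg h0] at this
  have hι : ∀ i, ∃ l : Ω i → Λ i, StronglyMeasurable l ∧ MemLp l 2 (m i) ∧
      Tendsto (fun n => eLpNorm ((L n).ι i ∘ a n i - l) 2 (m i)) atTop (𝓝 0) := fun i =>
    exists_tendsto_eLpNorm_sub_of_le_geometric
      (fun n => label_comp_memLp (ha n) i) (C := 2) (by simp) fun n => hdisc n (Sum.inr i)
  choose K hK0 hKm hKlim using hK
  choose l hl hlm hllim using hι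
  let M : LabelledNetwork.{u, v} k Λ :=
    ofKernels Ω m K hK0 hKm l (fun i => (hl i).measurable) hlm
  refine ⟨M, ?_⟩
  have hid : ∀ i, MeasurePreserving (id : Ω i → M.X i) (m i) (M.μ i) := fun i => .id _
  have hl2 : Tendsto (fun n => 1 / 2 * ENNReal.l2Norm
      (pullbackDiscrepancy (L n) M m (a n) (fun i => (id : Ω i → M.X i)))) atTop (𝓝 0) := by
    have := ENNReal.Tendsto.const_mul (a := 1 / 2) (ENNReal.tendsto_l2Norm_zero (a := fun n =>
      pullbackDiscrepancy (L n) M m (a n) (fun i => (id : Ω i → M.X i))) (l := atTop) ?_)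
      (Or.inr (by simp))
    · simpa using this
    · rintro (⟨i, j⟩ | i)
      · exact hKlim i j
      · exact hllim i
  exact tendsto_of_tendsto_of_tendsto_of_le_of_le tendsto_const_nhds hl2
    (fun _ => zero_le) fun n => networkDist_le (ha n) hid

/-! ### Passage to weak isomorphism classes -/

theorem weaklyIsomorphic_refl (L : LabelledNetwork.{u, v} k Λ) : L.WeaklyIsomorphic L :=
  ⟨L, fun _ => id, fun _ => id, ⟨fun _ => .id _, fun _ _ => ae_of_all _ fun _ => rfl⟩,
    ⟨fun _ => .id _, fun _ _ => ae_of_all _ fun _ => rfl⟩, fun _ => ae_of_all _ fun _ => ⟨rfl, rfl⟩⟩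

theorem networkDist_congr {L L' M M' : LabelledNetwork.{u, v} k Λ}
    (h : L.WeaklyIsomorphic L') (h' : M.WeaklyIsomorphic M') :
    networkDist L M = networkDist L' M' := by
  have h0 := h.networkDist_eq_zero
  have h0' := h'.networkDist_eq_zero
  apply le_antisymm
  · calc networkDist L M ≤ networkDist L L' + networkDist L' M := networkDist_triangle _ _ _
      _ ≤ networkDist L L' + (networkDist L' M' + networkDist M' M) := by
          gcongr; exact networkDist_triangle _ _ _
      _ = networkDist L' M' := by rw [h0, networkDist_comm M', h0', zero_add, add_zero]
  · calc networkDist L' M' ≤ networkDist L' L + networkDist L M' := networkDist_triangle _ _ _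
      _ ≤ networkDist L' L + (networkDist L M + networkDist M M') := by
          gcongr; exact networkDist_triangle _ _ _
      _ = networkDist L M := by rw [networkDist_comm L', h0, h0', zero_add, add_zero]

end LabelledNetwork

namespace LabelledNetworkClass

variable {k : ℕ} {Λ : Fin k → Type v} [∀ i, NormedAddCommGroup (Λ i)]
  [∀ i, MeasurableSpace (Λ i)] [∀ i, BorelSpace (Λ i)]

open LabelledNetwork

/-- The network distance on weak isomorphism classes. -/
noncomputable def classDist (x y : LabelledNetworkClass.{u, v} k Λ) : ℝ≥0∞ :=
  Quot.lift₂ networkDist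
    (fun L _ _ h => networkDist_congr (weaklyIsomorphic_refl L) h)
    (fun _ _ M h => networkDist_congr h (weaklyIsomorphic_refl M)) x y

/-- The extended metric space of weak isomorphism classes. -/
noncomputable abbrev emetricSpace [∀ i, NormedSpace ℝ (Λ i)] :
    EMetricSpace (LabelledNetworkClass.{u, v} k Λ) where
  edist := classDist
  edist_self := by rintro ⟨L⟩; exact networkDist_self L
  edist_comm := by rintro ⟨L⟩ ⟨M⟩; exact networkDist_comm L M
  edist_triangle := by rintro ⟨L⟩ ⟨M⟩ ⟨N⟩; exact networkDist_triangle L M N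
  eq_of_edist_eq_zero := by
    rintro ⟨L⟩ ⟨M⟩ h
    exact Quot.sound (weaklyIsomorphic_of_networkDist_eq_zero h)

open Filter Topology in
theorem completeSpace [∀ i, NormedSpace ℝ (Λ i)] [∀ i, CompleteSpace (Λ i)] :
    letI := emetricSpace (k := k) (Λ := Λ)
    CompleteSpace (LabelledNetworkClass.{u, v} k Λ) := by
  let _ := emetricSpace.{u, v} (k := k) (Λ := Λ)
  -- It suffices to treat sequences with geometrically controlled gaps, for which representatives
  -- can be chosen freely.
  refine EMetric.complete_of_convergent_controlled_sequences (fun n => (2 : ℝ≥0∞)⁻¹ ^ n)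
    (fun n => by simp [pos_iff_ne_zero]) fun x hx => ?_
  choose L hL using fun n => Quot.exists_rep (x n)
  obtain rfl : (fun n => (L n).toClass) = x := funext hL
  obtain ⟨M, hM⟩ := exists_tendsto_networkDist L fun n => hx n n (n + 1) le_rfl n.le_succ
  exact ⟨M.toClass, tendsto_iff_edist_tendsto_0.2 hM⟩

end LabelledNetworkClass

/-- The labelled network distance descends to a metric on weak isomorphism classes, and the
resulting metric space is complete when the label spaces are Hilbert spaces. -/
theorem proposition3 (k : ℕ) (hk : 1 ≤ k) (Λ : Fin k → Type v)
    [∀ i, NormedAddCommGroup (Λ i)] [∀ i, InnerProductSpace ℝ (Λ i)] [∀ i, CompleteSpace (Λ i)]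
    [∀ i, MeasurableSpace (Λ i)] [∀ i, BorelSpace (Λ i)] :
    ∃ m : MetricSpace (LabelledNetworkClass.{u, v} k Λ),
      (∀ L L' : LabelledNetwork.{u, v} k Λ,
        edist L.toClass L'.toClass = L.networkDist L') ∧
      CompleteSpace (LabelledNetworkClass.{u, v} k Λ) := by
  let _ := LabelledNetworkClass.emetricSpace.{u, v} (k := k) (Λ := Λ)
  refine ⟨EMetricSpace.toMetricSpace ?_, fun _ _ => rfl, LabelledNetworkClass.completeSpace⟩
  rintro ⟨L⟩ ⟨L'⟩
  exact (LabelledNetwork.networkDist_lt_top L L').ne
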